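/- Let $E$ and $F$ be complex Banach spaces, $U\subseteq E$ open, $v\colon U\to(0,\infty)$ continuous, $p\in[1,\infty)$, and $p^*$ the conjugate index of $p$. Definitions. Let $X_p:=\ell_{p^*}$ if $p>1$ and $X_1:=c_0$ (complex scalar sequences). For a complex Banach space $Y$ and $(y_n)\in\ell_p(Y)$ put $p\text{-}\mathrm{conv}(y_n)=\{\sum_{n} a_ny_n\colon (a_n)\in X_p,\ \|(a_n)\|\le 1\}$. A set $K\subseteq Y$ is relatively $p$-compact if $K\subseteq p\text{-}\mathrm{conv}(y_n)$ for some $(y_n)\in\ell_p(Y)$, and then $m_{\mathcal K_p}(K)$ denotes the infimum of $\|(y_n)\|_p=(\sum_n\|y_n\|^p)^{1/p}$ over all such $(y_n)$. For complex Banach spaces $X,Y$ with closed unit ball $B_X$ of $X$, $\mathcal K(X,Y)$ is the set of compact linear operators, and $\mathcal K_p(X,Y)$ is the set of bounded linear operators $T\colon X\to Y$ with $T(B_X)$ relatively $p$-compact, with $\|T\|_{\mathcal K_p}=m_{\mathcal K_p}(T(B_X))$. For a map $h\colon U\to Y$ let $(vh)(U)=\{v(x)h(x)\colon x\in U\}$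 and $\|h\|_v=\sup_{x\in U}v(x)\|h(x)\|$ (read as $0$ if $U=\emptyset$). $\mathcal H^\infty_v(U,Y)$ is the set of holomorphic $h\colon U\to Y$ with $\|h\|_v<\infty$; $\mathcal H^\infty_{v\mathcal K}(U,Y)$ is the set of holomorphic $h\colon U\to Y$ with $(vh)(U)$ relatively compact; $\mathcal H^\infty_{v\mathcal K_p}(U,Y)$ is the set of $h\in\mathcal H^\infty_v(U,Y)$ with $(vh)(U)$ relatively $p$-compact, with $\|h\|_{\mathcal H^\infty_{v\mathcal K_p}}=m_{\mathcal K_p}((vh)(U))$. Statement. Let $f\in\mathcal H^\infty_v(U,F)$. The following are equivalent: (i) $f\in\mathcal H^\infty_{v\mathcal K_p}(U,F)$; (ii) there exist a closed subspace $M$ of $X_p$, a separable complex Banach space $G$, an operator $T\in\mathcal K_p(X_p/M,G)$, a mapping $g\in\mathcal H^\infty_{v\mathcal K}(U,X_p/M)$ and an operator $S\in\mathcal K(G,F)$ such that $f=S\circ T\circ g$. In this case, $\|f\|_{\mathcal H^\infty_{v\mathcal K_p}}=\inf\{\|S\|\,\|T\|_{\mathcal K_p}\,\|g\|_v\}$,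 where the infimum is taken over all factorizations of $f$ as in (ii). -/

import Mathlib

open scoped ENNReal Topology

universe w

noncomputable section

namespace WeightedHol

/-- The conjugate exponent satisfies `1 ≤ p*`, so that `ℓ_{p*}` is a normed space. -/
instance fact_one_le_conjExponent (p : ℝ≥0∞) : Fact (1 ≤ ENNReal.conjExponent p) :=
  ⟨by simp [ENNReal.conjExponent]⟩

/-- The subspace of `ℓ_{p*}` underlying `DualSeq p`: all of `ℓ_{p*}` if `p ≠ 1`, and the null
sequences of `ℓ_{p*} = ℓ_∞` if `p = 1`. -/
def dualSeqSubmodule (p : ℝ≥0∞) :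
    Submodule ℂ (lp (fun _ : ℕ => ℂ) (ENNReal.conjExponent p)) where
  carrier := {a | p = 1 → Filter.Tendsto (fun n => a n) Filter.atTop (𝓝 0)}
  add_mem' := by
    intro a b ha hb hp
    simpa using (ha hp).add (hb hp)
  zero_mem' := by
    intro _
    simp
  smul_mem' := by
    intro c a ha hp
    simpa using (ha hp).const_mul c

/-- The complex sequence space `ℓ_{p*}` if `p ≠ 1`, and `c₀` with the supremum norm if `p = 1`. -/
def DualSeq (p : ℝ≥0∞) : Type := dualSeqSubmodule p

instance (p : ℝ≥0∞) : NormedAddCommGroup (DualSeq p) :=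
  inferInstanceAs (NormedAddCommGroup (dualSeqSubmodule p))

instance (p : ℝ≥0∞) : NormedSpace ℂ (DualSeq p) :=
  inferInstanceAs (NormedSpace ℂ (dualSeqSubmodule p))

/-- The sequence of coordinates of an element of `DualSeq p`. -/
def DualSeq.coord {p : ℝ≥0∞} (a : DualSeq p) (n : ℕ) : ℂ :=
  (Subtype.val a : lp (fun _ : ℕ => ℂ) (ENNReal.conjExponent p)) n

section PCompact

variable {X F : Type*} [SeminormedAddCommGroup X] [NormedSpace ℂ X]
  [NormedAddCommGroup F] [NormedSpace ℂ F]

/-- The `p`-convex hull of a sequence `x`: all sums `∑ aₙ xₙ` with `a` in the closed unit ball of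
`ℓ_{p*}` (of `c₀` if `p = 1`). -/
def pConv (p : ℝ≥0∞) (x : ℕ → F) : Set F :=
  {y | ∃ a : DualSeq p, ‖a‖ ≤ 1 ∧ HasSum (fun n => a.coord n • x n) y}

/-- Relatively `p`-compact sets, for `1 ≤ p < ∞`. -/
def IsRelPCompact (p : ℝ≥0∞) (K : Set F) : Prop :=
  ∃ x : lp (fun _ : ℕ => F) p, K ⊆ pConv p x

/-- The measure `m_{K_p}` of a relatively `p`-compact set, for `1 ≤ p < ∞`. -/
def pCompactMeasure (p : ℝ≥0∞) (K : Set F) : ℝ :=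
  sInf {r | ∃ x : lp (fun _ : ℕ => F) p, K ⊆ pConv p x ∧ r = ‖x‖}

/-- `p`-compact operators, for `1 ≤ p < ∞`. -/
def IsPCompactOperator (p : ℝ≥0∞) (T : X →L[ℂ] F) : Prop :=
  IsRelPCompact p (T '' Metric.closedBall 0 1)

/-- The `p`-compact norm of a `p`-compact operator. -/
def pCompactOpNorm (p : ℝ≥0∞) (T : X →L[ℂ] F) : ℝ :=
  pCompactMeasure p (T '' Metric.closedBall 0 1)

end PCompact

section Weighted

variable {E X F : Type*} [NormedAddCommGroup E] [NormedSpace ℂ E]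
  [SeminormedAddCommGroup X] [NormedSpace ℂ X] [NormedAddCommGroup F] [NormedSpace ℂ F]

/-- A weight on `U`: a strictly positive continuous function. -/
def IsWeight (U : Set E) (v : E → ℝ) : Prop :=
  ContinuousOn v U ∧ ∀ x ∈ U, 0 < v x

/-- The set `(vf)(U)`. -/
def vRange (U : Set E) (v : E → ℝ) (f : E → X) : Set X :=
  (fun x => (v x : ℂ) • f x) '' U

/-- Membership in `H^∞_v(U, X)`; maps on `U` are represented by maps on the whole space, whose
values outside `U` are irrelevant. -/
def MemHv (U : Set E) (v : E → ℝ) (f : E → X) : Prop :=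
  DifferentiableOn ℂ f U ∧ BddAbove ((fun x => v x * ‖f x‖) '' U)

/-- The weighted supremum norm (it is `0` if `U` is empty). -/
def vNorm (U : Set E) (v : E → ℝ) (f : E → X) : ℝ :=
  sSup ((fun x => v x * ‖f x‖) '' U)

/-- Membership in `H^∞_{vK}(U, X)`: holomorphic with relatively compact `(vf)(U)`. -/
def MemHvK (U : Set E) (v : E → ℝ) (f : E → X) : Prop :=
  DifferentiableOn ℂ f U ∧ IsCompact (closure (vRange U v f))

/-- Membership in `H^∞_{vK_p}(U, F)`. -/
def MemHvKp (p : ℝ≥0∞) (U : Set E) (v : E → ℝ) (f : E → F) : Prop :=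
  MemHv U v f ∧ IsRelPCompact p (vRange U v f)

/-- The norm of `H^∞_{vK_p}(U, F)`. -/
def vKpNorm (p : ℝ≥0∞) (U : Set E) (v : E → ℝ) (f : E → F) : ℝ :=
  pCompactMeasure p (vRange U v f)

/-- `f = S ∘ T ∘ g` on `U`, where `M` is a closed subspace of `ℓ_{p*}` (of `c₀` if `p = 1`),
`T : ℓ_{p*}/M → G` is `p`-compact, `g ∈ H^∞_{vK}(U, ℓ_{p*}/M)`, and `S : G → F` is compact. -/
def IsFactorization {G : Type*} [NormedAddCommGroup G] [NormedSpace ℂ G]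
    (p : ℝ≥0∞) (U : Set E) (v : E → ℝ) (f : E → F) (M : Submodule ℂ (DualSeq p))
    (T : (DualSeq p ⧸ M) →L[ℂ] G) (g : E → DualSeq p ⧸ M) (S : G →L[ℂ] F) : Prop :=
  IsClosed (M : Set (DualSeq p)) ∧ IsPCompactOperator p T ∧ MemHvK U v g ∧
    IsCompactOperator S ∧ ∀ x ∈ U, f x = S (T (g x))

end Weighted

end WeightedHol

end

/-! Suppose $(vf)(U)\subseteq p\text{-}\mathrm{conv}(y_n)$. Choose a null sequence $t_n\in(0,1]$ for
which $\beta_n=\|y_n\|/t_n^2$ still lies in $\ell_p$ with norm barely above $\|y\|$, and split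
$y_n=t_n\cdot\beta_n\cdot t_n\,y_n/\|y_n\|$. Then $a\mapsto\sum a_ny_n$ becomes $S_0BD$, with $D$
the compact diagonal operator $t$ on $X_p$, $B\colon X_p\to\ell_1$ multiplication by $\beta$, and
$S_0\colon\ell_1\to F$, $e_n\mapsto t_ny_n/\|y_n\|$, compact. Dividing out kernels turns $S_0$ and
$B$ into injective operators $S$ and $T$. Pick any coefficients $a(x)$ representing $v(x)f(x)$, and
let $k(x)$ be the class of $Da(x)$, $g=k/v$. No regularity of $a$ is needed: $k$ has values in a
compact set, on which the injective $ST$ is a homeomorphism onto its image, so $k$ is continuous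
because $STk=vf$ is. A continuous map that is holomorphic after an injective operator is holomorphic
(`differentiableOn_of_injective_comp`), hence so is $g$. This is `exists_isFactorization`.
Conversely, a factorization carries a $p$-convex hull containing $T(B)$, $B$ the unit ball, to one
containing $(vf)(U)$ (`IsFactorization.exists_vRange_subset_pConv`), which also gives one norm
inequality; the other comes from the constants above. -/

namespace WeightedHol

open Filter Set Metric

/-! ### Absorbing null sequences into $\ell_p$ sequences. -/

section Sequences

/-- A convergent series of nonnegative terms can be multiplied by an unbounded sequence of weights
without losing convergence. -/
theorem exists_tendsto_atTop_summable_mul {c : ℕ → ℝ} (hc0 : ∀ n, 0 ≤ c n) (hc : Summable c) :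
    ∃ b : ℕ → ℝ, (∀ n, 0 ≤ b n) ∧ Tendsto b atTop atTop ∧ Summable fun n => c n * b n := by
  set r : ℕ → ℝ := fun n => ∑' k, c (k + n) with hr
  have hr0 : ∀ n, 0 ≤ r n := fun n => tsum_nonneg fun k => hc0 _
  have hrt : Tendsto r atTop (𝓝 0) := tendsto_sum_nat_add c
  have hrs : ∀ n, r n = c n + r (n + 1) := by
    intro n
    have h := ((summable_nat_add_iff n).2 hc).tsum_eq_zero_add
    simp only [hr, h, zero_add]
    congr 1
    exact tsum_congr fun k => by congr 1; ring
  -- The weights are $1/m_n$ with $m_n$ essentially the root of the tail sum; the maximum keeps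
  -- $m_n>0$ when the tail vanishes.
  set m : ℕ → ℝ := fun n => max (√(r n)) (1 / ((n : ℝ) + 1)) with hm
  have hm0 : ∀ n, 0 < m n := fun n => lt_max_of_lt_right (by positivity)
  have hmt : Tendsto m atTop (𝓝 0) := by
    have h1 : Tendsto (fun n => √(r n)) atTop (𝓝 0) := by
      simpa using hrt.sqrt
    simpa [hm] using h1.max tendsto_one_div_add_atTop_nhds_zero_nat
  refine ⟨fun n => (m n)⁻¹, fun n => (inv_pos.2 (hm0 n)).le, ?_, ?_⟩
  · exact tendsto_inv_nhdsGT_zero.comp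
      (tendsto_nhdsWithin_iff.2 ⟨hmt, Eventually.of_forall hm0⟩)
  -- Telescoping: $c_n=r_n-r_{n+1}=(\sqrt{r_n}-\sqrt{r_{n+1}})(\sqrt{r_n}+\sqrt{r_{n+1}})$, and the
  -- second factor is at most $2\sqrt{r_n}$.
  · have key : ∀ n, c n * (m n)⁻¹ ≤ 2 * (√(r n) - √(r (n + 1))) := by
      intro n
      rw [← div_eq_mul_inv, div_le_iff₀ (hm0 n)]
      have hle : √(r (n + 1)) ≤ √(r n) := Real.sqrt_le_sqrt (by linarith [hrs n, hc0 n])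
      have h1 := Real.sq_sqrt (hr0 n)
      have h2 := Real.sq_sqrt (hr0 (n + 1))
      have h3 : c n ≤ 2 * (√(r n) - √(r (n + 1))) * √(r n) := by
        nlinarith [hrs n, sq_nonneg (√(r n) - √(r (n + 1)))]
      exact h3.trans (mul_le_mul_of_nonneg_left (le_max_left _ _) (by linarith))
    refine summable_of_sum_range_le (c := 2 * √(r 0))
      (fun n => mul_nonneg (hc0 n) (inv_pos.2 (hm0 n)).le) fun n => ?_
    calc ∑ i ∈ Finset.range n, c i * (m i)⁻¹
        ≤ ∑ i ∈ Finset.range n, 2 * (√(r i) - √(r (i + 1))) := Finset.sum_le_sum fun i _ => key i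
      _ = 2 * (√(r 0) - √(r n)) := by rw [← Finset.mul_sum, Finset.sum_range_sub']
      _ ≤ 2 * √(r 0) := by linarith [Real.sqrt_nonneg (r n)]

/-- A convergent series of nonnegative terms can be divided by a null sequence with an arbitrarily
small increase of its sum. -/
theorem exists_null_seq_summable_div {c : ℕ → ℝ} (hc0 : ∀ n, 0 ≤ c n) (hc : Summable c) {A : ℝ}
    (hA : ∑' n, c n < A) :
    ∃ τ : ℕ → ℝ, (∀ n, 0 < τ n) ∧ (∀ n, τ n ≤ 1) ∧ Tendsto τ atTop (𝓝 0) ∧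
      Summable (fun n => c n / τ n) ∧ ∑' n, c n / τ n ≤ A := by
  obtain ⟨b, hb0, hbt, hbs⟩ := exists_tendsto_atTop_summable_mul hc0 hc
  set C := ∑' n, c n * b n
  have hC : 0 ≤ C := tsum_nonneg fun n => mul_nonneg (hc0 n) (hb0 n)
  -- With $\tau_n=1/(1+\delta b_n)$ the sum grows by exactly $\delta C$, which must fit in the gap
  -- below $A$.
  set δ := (A - ∑' n, c n) / (C + 1)
  have hδ : 0 < δ := div_pos (by linarith) (by linarith)
  have hδC : δ * C ≤ A - ∑' n, c n := by
    rw [div_mul_eq_mul_div, div_le_iff₀ (by linarith)]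
    nlinarith
  have hpos : ∀ n, 1 ≤ 1 + δ * b n := fun n => by
    have := mul_nonneg hδ.le (hb0 n)
    linarith
  have heq : (fun n => c n / (1 + δ * b n)⁻¹) = fun n => c n + δ * (c n * b n) := by
    funext n
    rw [div_inv_eq_mul]
    ring
  refine ⟨fun n => (1 + δ * b n)⁻¹, fun n => inv_pos.2 (by linarith [hpos n]),
    fun n => inv_le_one_of_one_le₀ (hpos n), ?_, ?_, ?_⟩
  · exact tendsto_inv_atTop_zero.comp (tendsto_atTop_add_const_left _ _ (hbt.const_mul_atTop hδ))
  · rw [heq]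
    exact hc.add (hbs.mul_left δ)
  · rw [heq, hc.tsum_add (hbs.mul_left δ), tsum_mul_left]
    linarith

/-- An `ℓ_p` sequence of vectors can be divided by the square of a null sequence of scalars with an
arbitrarily small increase of its norm. -/
theorem exists_null_seq_lp_div_sq {F : Type*} [NormedAddCommGroup F] {p : ℝ≥0∞}
    (hp : 1 ≤ p) (hp' : p ≠ ∞) (y : lp (fun _ : ℕ => F) p) {η : ℝ} (hη : ‖y‖ < η) :
    ∃ (t : ℕ → ℝ) (β : lp (fun _ : ℕ => ℂ) p), (∀ n, 0 < t n) ∧ (∀ n, t n ≤ 1) ∧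
      Tendsto t atTop (𝓝 0) ∧ ‖β‖ ≤ η ∧ ∀ n, β n = ((‖y n‖ / t n ^ 2 : ℝ) : ℂ) := by
  have hP : 0 < p.toReal := ENNReal.toReal_pos (zero_lt_one.trans_le hp).ne' hp'
  have hη0 : 0 ≤ η := (lp.norm_nonneg' y).trans hη.le
  obtain ⟨τ, hτ0, hτ1, hτt, hτs, hτA⟩ := exists_null_seq_summable_div
    (c := fun n => ‖y n‖ ^ p.toReal) (fun n => by positivity) ((lp.memℓp y).summable hP)
    (A := η ^ p.toReal) (by
      rw [← lp.norm_rpow_eq_tsum hP]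
      exact Real.rpow_lt_rpow (lp.norm_nonneg' y) hη hP)
  -- The exponent makes $(t_n^2)^p=\tau_n$. The square leaves one factor $t_n$ for each of two
  -- compact operators.
  set t : ℕ → ℝ := fun n => τ n ^ (1 / (2 * p.toReal)) with ht
  have ht0 : ∀ n, 0 < t n := fun n => Real.rpow_pos_of_pos (hτ0 n) _
  have htp : ∀ n, (t n ^ 2) ^ p.toReal = τ n := by
    intro n
    rw [← Real.rpow_natCast, ← Real.rpow_mul (ht0 n).le, ht, ← Real.rpow_mul (hτ0 n).le]
    convert Real.rpow_one (τ n) using 2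
    push_cast
    field_simp
  have heq : (fun n => ‖((‖y n‖ / t n ^ 2 : ℝ) : ℂ)‖ ^ p.toReal) =
      fun n => ‖y n‖ ^ p.toReal / τ n := by
    funext n
    rw [Complex.norm_real, Real.norm_of_nonneg (by have := ht0 n; positivity),
      Real.div_rpow (norm_nonneg _) (by positivity), htp]
  have hmem : Memℓp (fun n => ((‖y n‖ / t n ^ 2 : ℝ) : ℂ)) p := memℓp_gen (by rwa [heq])
  refine ⟨t, ⟨_, hmem⟩, ht0, fun n => Real.rpow_le_one (hτ0 n).le (hτ1 n) (by positivity), ?_, ?_,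
    fun n => rfl⟩
  · have := hτt.rpow_const (p := 1 / (2 * p.toReal)) (Or.inr (by positivity))
    rwa [Real.zero_rpow (by positivity)] at this
  · refine lp.norm_le_of_tsum_le hP hη0 ?_
    change ∑' n, ‖((‖y n‖ / t n ^ 2 : ℝ) : ℂ)‖ ^ p.toReal ≤ _
    rwa [heq]

end Sequences

/-! ### Holomorphy detected through an injective operator. -/

section Holomorphy

/-- A map with values in a compact set is continuous if it is so after a continuous injection. -/
theorem continuousOn_of_injective_comp {E W F : Type*} [TopologicalSpace E] [TopologicalSpace W]
    [TopologicalSpace F] [T2Space F] {A : W → F} (hAc : Continuous A)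
    (hA : Function.Injective A) {K : Set W} (hK : IsCompact K) {U : Set E} {k : E → W}
    (hk : MapsTo k U K) (h : ContinuousOn (fun x => A (k x)) U) : ContinuousOn k U := by
  have := isCompact_iff_compactSpace.1 hK
  have hemb : Topology.IsClosedEmbedding (fun z : K => A z) :=
    (hAc.comp continuous_subtype_val).isClosedEmbedding (hA.comp Subtype.val_injective)
  rw [continuousOn_iff_continuous_domRestrict] at h ⊢
  have : Continuous (fun x : U => (⟨k x, hk x.2⟩ : K)) :=
    hemb.isInducing.continuous_iff.2 h
  exact continuous_subtype_val.comp this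

variable {E W F : Type*} [NormedAddCommGroup E] [NormedSpace ℂ E] [NormedAddCommGroup W]
  [NormedSpace ℂ W] [CompleteSpace W] [NormedAddCommGroup F] [NormedSpace ℂ F] [CompleteSpace F]

theorem _root_.ContinuousLinearMap.circleIntegral_comp_comm (A : W →L[ℂ] F) {φ : ℂ → W} {c : ℂ}
    {R : ℝ} (hφ : CircleIntegrable φ c R) :
    (∮ z in C(c, R), A (φ z)) = A (∮ z in C(c, R), φ z) := by
  rw [circleIntegral, circleIntegral, ← A.intervalIntegral_comp_comm hφ.out]
  simp

/-- A continuous function on a disc that becomes holomorphic after an injective operator is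
holomorphic. -/
theorem differentiableOn_ball_of_injective_comp {A : W →L[ℂ] F} (hA : Function.Injective A)
    {φ : ℂ → W} {R : ℝ} (hφ : ContinuousOn φ (closedBall 0 R))
    (hd : DifferentiableOn ℂ (fun z => A (φ z)) (ball 0 R)) :
    DifferentiableOn ℂ φ (ball 0 R) := by
  rcases le_or_gt R 0 with hR | hR
  · rw [ball_eq_empty.2 hR]
    exact differentiableOn_empty
  lift R to NNReal using hR.le
  have hcs : ContinuousOn φ (sphere 0 R) := hφ.mono sphere_subset_closedBall
  have hci : CircleIntegrable φ 0 R := hcs.circleIntegrable hR.le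
  -- The Cauchy integral of $\varphi$ is holomorphic in any case. It equals $\varphi$ because $A$
  -- commutes with the integral, Cauchy's formula holds for $A\varphi$, and $A$ is injective.
  have hps := hasFPowerSeriesOn_cauchy_integral hci (by exact_mod_cast hR)
  have hdi := hps.differentiableOn
  rw [Metric.eball_coe] at hdi
  refine hdi.congr fun w hw => hA ?_
  have hdc : DiffContOnCl ℂ (fun z => A (φ z)) (ball 0 R) :=
    ⟨hd, by rw [closure_ball _ hR.ne']; exact A.continuous.comp_continuousOn hφ⟩
  have hci' : CircleIntegrable (fun z => (z - w)⁻¹ • φ z) 0 R := by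
    refine ContinuousOn.circleIntegrable hR.le (ContinuousOn.smul ?_ hcs)
    refine ContinuousOn.inv₀ (by fun_prop) fun z hz h => ?_
    rw [sub_eq_zero] at h
    subst h
    rw [mem_ball] at hw
    rw [mem_sphere] at hz
    exact hw.ne hz
  rw [← hdc.two_pi_i_inv_smul_circleIntegral_sub_inv_smul hw, map_smul,
    ← A.circleIntegral_comp_comm hci']
  simp

/-- A continuous map that becomes holomorphic after an injective operator is holomorphic. -/
theorem differentiableOn_of_injective_comp {A : W →L[ℂ] F} (hA : Function.Injective A)
    {U : Set E} (hU : IsOpen U) {g : E → W} (hg : ContinuousOn g U)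
    (hd : DifferentiableOn ℂ (fun x => A (g x)) U) : DifferentiableOn ℂ g U := by
  intro x hx
  refine DifferentiableAt.differentiableWithinAt ?_
  obtain ⟨r, hr, hrU, hrg⟩ : ∃ r > 0, ball x r ⊆ U ∧ ∀ y ∈ ball x r, ‖g y - g x‖ ≤ 1 := by
    have h1 := Metric.continuousAt_iff.1 (hg.continuousAt (hU.mem_nhds hx)) 1 one_pos
    obtain ⟨r₁, hr₁, h1⟩ := h1
    obtain ⟨r₂, hr₂, h2⟩ := Metric.isOpen_iff.1 hU x hx
    refine ⟨min r₁ r₂, lt_min hr₁ hr₂, (ball_subset_ball (min_le_right _ _)).trans h2,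
      fun y hy => ?_⟩
    rw [← dist_eq_norm]
    exact (h1 (lt_of_lt_of_le hy (min_le_left _ _))).le
  -- behaviour of `g` on the complex lines through `x`
  have hline : ∀ (h : E) (τ : ℂ) (R : ℝ), R * ‖h‖ ≤ r → τ ∈ ball (0 : ℂ) R →
      x + τ • h ∈ ball x r := by
    intro h τ R hR hτ
    rw [mem_ball_zero_iff] at hτ
    rw [mem_ball, dist_eq_norm, add_sub_cancel_left, norm_smul]
    rcases (norm_nonneg h).eq_or_lt' with h0 | h0
    · rw [h0, mul_zero]; exact hr
    · exact (mul_lt_mul_of_pos_right hτ h0).trans_le hR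
  have hdiff : ∀ (h : E) (R : ℝ), R * ‖h‖ ≤ r →
      DifferentiableOn ℂ (fun τ : ℂ => g (x + τ • h)) (ball 0 R) := by
    intro h R hR τ hτ
    have hτ' := mem_ball_zero_iff.1 hτ
    obtain ⟨R', h1, h2⟩ := exists_between hτ'
    have hsub : closedBall (0 : ℂ) R' ⊆ ball 0 R := closedBall_subset_ball h2
    have hmap : MapsTo (fun τ : ℂ => x + τ • h) (ball 0 R) U :=
      fun τ hτ => hrU (hline h τ R hR hτ)
    have hc : ContinuousOn (fun τ : ℂ => g (x + τ • h)) (closedBall 0 R') :=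
      hg.comp (by fun_prop) (hmap.mono_left hsub)
    have hdd : DifferentiableOn ℂ (fun τ : ℂ => A (g (x + τ • h))) (ball 0 R') :=
      hd.comp (f := fun τ : ℂ => x + τ • h) (by fun_prop)
        (hmap.mono_left (ball_subset_closedBall.trans hsub))
    exact ((differentiableOn_ball_of_injective_comp hA hc hdd).differentiableAt
      (isOpen_ball.mem_nhds (mem_ball_zero_iff.2 h1))).differentiableWithinAt
  have hmaps : ∀ (h : E) (R : ℝ), R * ‖h‖ ≤ r →
      MapsTo (fun τ : ℂ => g (x + τ • h)) (ball 0 R) (closedBall (g (x + (0 : ℂ) • h)) 1) := by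
    intro h R hR τ hτ
    rw [mem_closedBall, dist_eq_norm, zero_smul, add_zero]
    exact hrg _ (hline h τ R hR hτ)
  set L := fderiv ℂ (fun y => A (g y)) x
  have hL : HasFDerivAt (fun y => A (g y)) L x :=
    (hd.differentiableAt (hU.mem_nhds hx)).hasFDerivAt
  -- The candidate derivative is made of directional derivatives. Its linearity is inherited from
  -- $L$ through $AD=L$ and injectivity; its boundedness is a Schwarz estimate.
  set D : E → W := fun h => deriv (fun τ : ℂ => g (x + τ • h)) 0 with hDdef
  have hR : ∀ h : E, ∃ R > 0, R * ‖h‖ ≤ r := fun h =>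
    ⟨r / (‖h‖ + 1), by positivity, by
      rw [div_mul_eq_mul_div, div_le_iff₀ (by positivity)]
      nlinarith [norm_nonneg h]⟩
  have hAD : ∀ h, A (D h) = L h := by
    intro h
    obtain ⟨R, hR0, hR⟩ := hR h
    have h1 : HasDerivAt (fun τ : ℂ => g (x + τ • h)) (D h) 0 :=
      ((hdiff h R hR).differentiableAt (ball_mem_nhds _ hR0)).hasDerivAt
    have h2 := A.hasFDerivAt.comp_hasDerivAt (0 : ℂ) h1
    have h3 : HasDerivAt (fun τ : ℂ => x + τ • h) h 0 := by
      simpa using ((hasDerivAt_id (0 : ℂ)).smul_const h).const_add x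
    have h4 := HasFDerivAt.comp_hasDerivAt (0 : ℂ) (f := fun τ : ℂ => x + τ • h)
      (by simpa using hL) h3
    exact h2.unique h4
  have hDn : ∀ h, ‖D h‖ ≤ r⁻¹ * ‖h‖ := by
    intro h
    rcases eq_or_ne h 0 with rfl | h0
    · simp [hDdef]
    · have hpos := norm_pos_iff.2 h0
      have hle : r / ‖h‖ * ‖h‖ ≤ r := by rw [div_mul_cancel₀ _ hpos.ne']
      have := Complex.norm_deriv_le_div_of_mapsTo_ball (hdiff h _ hle) (hmaps h _ hle)
        (div_pos hr hpos)
      calc ‖D h‖ ≤ _ := this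
        _ = _ := by field_simp
  let D' : E →L[ℂ] W := LinearMap.mkContinuous
    { toFun := D
      map_add' := fun h k => hA (by simp [hAD])
      map_smul' := fun c h => hA (by simp [hAD]) } r⁻¹ hDn
  -- Schwarz applied twice on the disc of radius $R=r/\|h\|$: the slope of $\varphi$ is bounded by
  -- $1/R$, so it stays within $2/R$ of its value at $0$, and its values at $1$ and $0$ therefore
  -- differ by at most $2/R^2$.
  have hrem : ∀ h : E, ‖h‖ < r → ‖g (x + h) - g x - D h‖ ≤ 2 / r ^ 2 * ‖h‖ ^ 2 := by
    intro h hh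
    rcases eq_or_ne h 0 with rfl | h0
    · simp [hDdef]
    have hpos := norm_pos_iff.2 h0
    set R := r / ‖h‖
    have hR1 : 1 < R := (one_lt_div hpos).2 hh
    have hR0 : 0 < R := one_pos.trans hR1
    have hle : R * ‖h‖ ≤ r := by rw [div_mul_cancel₀ _ hpos.ne']
    set φ : ℂ → W := fun τ => g (x + τ • h) with hφ
    have hφd : DifferentiableOn ℂ φ (ball 0 R) := hdiff h R hle
    have hψd : DifferentiableOn ℂ (dslope φ 0) (ball 0 R) :=
      (Complex.differentiableOn_dslope (ball_mem_nhds _ hR0)).2 hφd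
    have hψn : ∀ z ∈ ball (0 : ℂ) R, ‖dslope φ 0 z‖ ≤ 1 / R := fun z hz =>
      Complex.norm_dslope_le_div_of_mapsTo_ball hφd (hmaps h R hle) hz
    have hψm : MapsTo (dslope φ 0) (ball 0 R) (closedBall (dslope φ 0 0) (2 / R)) := by
      intro z hz
      rw [mem_closedBall, dist_eq_norm]
      calc _ ≤ ‖dslope φ 0 z‖ + ‖dslope φ 0 0‖ := norm_sub_le _ _
        _ ≤ 1 / R + 1 / R := add_le_add (hψn z hz) (hψn 0 (mem_ball_self hR0))
        _ = 2 / R := by ring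
    have := Complex.dist_le_div_mul_dist_of_mapsTo_ball hψd hψm
      (z := 1) (by simpa using hR1)
    rw [dslope_same, dslope_of_ne _ one_ne_zero, slope_def_module, dist_eq_norm] at this
    simp only [hφ, sub_zero, inv_one, one_smul, zero_smul, add_zero, dist_zero_right, norm_one,
      mul_one] at this
    calc _ ≤ _ := this
      _ = _ := by simp only [R]; field_simp
  have : HasFDerivAt g D' x := by
    rw [hasFDerivAt_iff_isLittleO_nhds_zero]
    have hO : (fun h : E => g (x + h) - g x - D' h) =O[𝓝 0] fun h : E => ‖h‖ ^ 2 := by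
      refine Asymptotics.IsBigO.of_bound (2 / r ^ 2) ?_
      filter_upwards [ball_mem_nhds (0 : E) hr] with h hh
      rw [norm_pow, norm_norm]
      exact hrem h (mem_ball_zero_iff.1 hh)
    refine hO.trans_isLittleO ?_
    exact Asymptotics.isLittleO_norm_pow_id one_lt_two
  exact this.differentiableAt

end Holomorphy


/-! ### Compact diagonal operators and factorization through quotients. -/

section Operators

/-- Coordinatewise operators given by a null sequence of vectors are compact. -/
theorem isCompactOperator_mapCLM {F : Type*} [NormedAddCommGroup F] [NormedSpace ℂ F]
    [CompleteSpace F] (q : ℝ≥0∞) [Fact (1 ≤ q)] {T : ℕ → ℂ →L[ℂ] F} {K : ℝ} (hK : 0 ≤ K)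
    (hTK : ∀ n, ‖T n‖ ≤ K) (hT : Tendsto (fun n => ‖T n‖) atTop (𝓝 0)) :
    IsCompactOperator (lp.mapCLM (E := fun _ : ℕ => ℂ) (F := fun _ : ℕ => F) q T hK hTK) := by
  classical
  -- Finite-rank truncations; they converge in operator norm because the error is at most the
  -- supremum of the remaining $\|T_n\|$.
  set P : ℕ → lp (fun _ : ℕ => ℂ) q →L[ℂ] lp (fun _ : ℕ => F) q := fun N =>
    ∑ i ∈ Finset.range N, (lp.singleContinuousLinearMap ℂ (fun _ : ℕ => F) q i).comp
      ((T i).comp (lp.evalCLM ℂ (fun _ : ℕ => ℂ) q i)) with hP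
  refine isCompactOperator_of_tendsto (l := atTop) (F := P) ?_ (Eventually.of_forall fun N => ?_)
  · rw [Metric.tendsto_atTop]
    intro ε hε
    obtain ⟨N, hN⟩ := eventually_atTop.1 (hT.eventually (gt_mem_nhds (half_pos hε)))
    refine ⟨N, fun m hm => ?_⟩
    have htail : ∀ n, ‖(if n < m then 0 else T n)‖ ≤ ε / 2 := by
      intro n
      split_ifs with h
      · simpa using (half_pos hε).le
      · exact (hN n (hm.trans (not_lt.1 h))).le
    have heq : lp.mapCLM q T hK hTK - P m = lp.mapCLM (E := fun _ : ℕ => ℂ)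
        (F := fun _ : ℕ => F) q (fun n => if n < m then 0 else T n) (half_pos hε).le htail := by
      ext x n
      have h1 : (P m x : ∀ _ : ℕ, F) n = if n < m then T n (x n) else 0 := by
        simp only [hP, sum_apply, lp.coeFn_sum, Finset.sum_apply,
          ContinuousLinearMap.comp_apply, lp.singleContinuousLinearMap_apply, lp.coeFn_single]
        exact (Finset.sum_pi_single n (fun i => T i (x i)) _).trans (by simp)
      rw [sub_apply, lp.coeFn_sub, Pi.sub_apply, h1, lp.mapCLM_apply_coe, lp.mapCLM_apply_coe]
      split_ifs <;> simp
    rw [dist_comm, dist_eq_norm, heq]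
    exact (lp.norm_mapCLM_le q _ _ _).trans_lt (half_lt_self hε)
  · refine Submodule.sum_mem (compactOperator (RingHom.id ℂ) _ _) fun i _ => ?_
    have h := isCompactOperator_of_locallyCompactSpace_rng
      ((lp.singleContinuousLinearMap ℂ (fun _ : ℕ => F) q i).comp (T i))
    exact h.comp_clm (lp.evalCLM ℂ (fun _ : ℕ => ℂ) q i)

variable {p : ℝ≥0∞}

/-- The inclusion of `DualSeq p` into `ℓ_{p*}`. -/
noncomputable def DualSeq.toLp (p : ℝ≥0∞) :
    DualSeq p →L[ℂ] lp (fun _ : ℕ => ℂ) (ENNReal.conjExponent p) :=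
  (dualSeqSubmodule p).subtypeL

theorem DualSeq.toLp_apply (a : DualSeq p) (n : ℕ) : DualSeq.toLp p a n = a.coord n := rfl

theorem DualSeq.norm_toLp (a : DualSeq p) : ‖DualSeq.toLp p a‖ = ‖a‖ := rfl

/-- For $p=1$, uniform limits of null sequences are null. Closedness yields completeness of `DualSeq
p` and keeps an operator compact when its codomain is restricted. -/
theorem isClosed_dualSeqSubmodule (p : ℝ≥0∞) : 
    IsClosed (dualSeqSubmodule p : Set (lp (fun _ : ℕ => ℂ) (ENNReal.conjExponent p))) := by
  by_cases hp : p = 1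
  · refine isClosed_of_closure_subset fun a ha _ => ?_
    rw [Metric.tendsto_atTop]
    intro ε hε
    obtain ⟨b, hb, hab⟩ := Metric.mem_closure_iff.1 ha (ε / 2) (half_pos hε)
    obtain ⟨N, hN⟩ := Metric.tendsto_atTop.1 (hb hp) (ε / 2) (half_pos hε)
    refine ⟨N, fun n hn => ?_⟩
    have h1 : dist (a n) (b n) ≤ dist a b := by
      rw [dist_eq_norm, dist_eq_norm]
      exact lp.norm_apply_le_norm (zero_lt_one.trans_le (fact_one_le_conjExponent p).out).ne'
        (a - b) n
    linarith [dist_triangle (a n) (b n) 0, hN n hn]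
  · convert isClosed_univ
    exact eq_univ_of_forall fun a h => absurd h hp

instance (p : ℝ≥0∞) : CompleteSpace (DualSeq p) :=
  (isClosed_dualSeqSubmodule p).completeSpace_coe

/-- Multiplication by a null sequence is a compact operator on `DualSeq p`, whose norm is at most
the supremum norm of the sequence. -/
theorem exists_isCompactOperator_diagonal (p : ℝ≥0∞) {t : ℕ → ℂ} (ht : Tendsto t atTop (𝓝 0))
    (ht1 : ∀ n, ‖t n‖ ≤ 1) :
    ∃ D : DualSeq p →L[ℂ] DualSeq p, IsCompactOperator D ∧ ‖D‖ ≤ 1 ∧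
      ∀ a n, (D a).coord n = t n * a.coord n := by
  have hT1 : ∀ n, ‖t n • ContinuousLinearMap.id ℂ ℂ‖ ≤ 1 := fun n => by
    simpa [norm_smul] using ht1 n
  set D₀ := (lp.mapCLM (E := fun _ : ℕ => ℂ) (F := fun _ : ℕ => ℂ) (ENNReal.conjExponent p)
    (fun n => t n • ContinuousLinearMap.id ℂ ℂ) zero_le_one hT1).comp (DualSeq.toLp p) with hD₀
  have hcoord : ∀ a n, D₀ a n = t n * a.coord n := fun a n => by
    simp [hD₀, lp.mapCLM_apply_coe, DualSeq.toLp_apply]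
  have hmem : ∀ a, D₀ a ∈ dualSeqSubmodule p := by
    intro a hp
    simp only [hcoord]
    have h : Tendsto (fun n => a.coord n) atTop (𝓝 0) := a.2 hp
    simpa using ht.mul h
  have hcomp : IsCompactOperator D₀ := by
    have h := isCompactOperator_mapCLM (ENNReal.conjExponent p) zero_le_one hT1
      (by simpa [norm_smul] using ht.norm)
    exact h.comp_clm (DualSeq.toLp p)
  have hn : ∀ a, ‖D₀ a‖ ≤ ‖a‖ := fun a => by
    have h := (lp.mapCLM (E := fun _ : ℕ => ℂ) (F := fun _ : ℕ => ℂ) (ENNReal.conjExponent p)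
      _ zero_le_one hT1).le_of_opNorm_le (lp.norm_mapCLM_le _ _ zero_le_one hT1)
      (DualSeq.toLp p a)
    rwa [one_mul, DualSeq.norm_toLp] at h
  let D : DualSeq p →L[ℂ] dualSeqSubmodule p := D₀.codRestrict (dualSeqSubmodule p) hmem
  have hD : IsCompactOperator D := hcomp.codRestrict hmem (isClosed_dualSeqSubmodule p)
  have hDn : ‖D‖ ≤ 1 := ContinuousLinearMap.opNorm_le_bound _ zero_le_one fun a => by
    rw [one_mul]
    exact hn a
  exact ⟨D, hD, hDn, hcoord⟩

/-- Multiplication by a sequence in `ℓ_p` maps `DualSeq p` continuously to `ℓ_1`. -/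
theorem exists_mul_toLp_one (hp : 1 ≤ p) (β : lp (fun _ : ℕ => ℂ) p) :
    ∃ D : DualSeq p →L[ℂ] lp (fun _ : ℕ => ℂ) 1, ∀ a n, D a n = a.coord n * β n := by
  have : Fact (1 ≤ p) := ⟨hp⟩
  have : (ENNReal.conjExponent p).HolderConjugate p := ENNReal.HolderTriple.symm
  refine ⟨((lp.holderL (p := ENNReal.conjExponent p) (q := p) (ι := ℕ) (E := fun _ => ℂ)
    (F := fun _ => ℂ) (G := fun _ => ℂ) 1 (fun _ => ContinuousLinearMap.mul ℂ ℂ) (K := 1)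
    (fun _ => by simp)).flip β).comp (DualSeq.toLp p), fun a n => rfl⟩

/-- A null sequence in the unit ball of a Banach space defines a compact contraction on `ℓ_1`. -/
theorem exists_isCompactOperator_of_tendsto_zero {F : Type*} [NormedAddCommGroup F]
    [NormedSpace ℂ F] [CompleteSpace F] {s : ℕ → F} (hs : Tendsto s atTop (𝓝 0))
    (hs1 : ∀ n, ‖s n‖ ≤ 1) :
    ∃ S : lp (fun _ : ℕ => ℂ) 1 →L[ℂ] F, IsCompactOperator S ∧ ‖S‖ ≤ 1 ∧
      ∀ a, HasSum (fun n => a n • s n) (S a) := by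
  set T : ℕ → ℂ →L[ℂ] F := fun n => ContinuousLinearMap.toSpanSingleton ℂ (s n) with hT
  have hTn : ∀ n, ‖T n‖ = ‖s n‖ := fun n => ContinuousLinearMap.norm_toSpanSingleton _
  have hT1 : ∀ n, ‖T n‖ ≤ 1 := fun n => (hTn n).trans_le (hs1 n)
  refine ⟨(lp.tsumCLM ℂ ℕ F).comp
    (lp.mapCLM (E := fun _ : ℕ => ℂ) (F := fun _ : ℕ => F) 1 T zero_le_one hT1), ?_, ?_, ?_⟩
  · have h := isCompactOperator_mapCLM 1 zero_le_one hT1 (by simpa [hTn] using hs.norm)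
    exact h.clm_comp (lp.tsumCLM ℂ ℕ F)
  · refine (ContinuousLinearMap.opNorm_comp_le _ _).trans ?_
    exact mul_le_one₀ lp.norm_tsumCLM_le (norm_nonneg _) (lp.norm_mapCLM_le _ _ _ _)
  · intro a
    exact (lp.memℓp (lp.mapCLM (E := fun _ : ℕ => ℂ) (F := fun _ : ℕ => F) 1 T zero_le_one hT1
      a)).summable_of_one.hasSum

instance separableSpace_lp_one : TopologicalSpace.SeparableSpace (lp (fun _ : ℕ => ℂ) 1) := by
  classical
  have h : TopologicalSpace.IsSeparable
      (closure (Submodule.span ℂ (range fun n : ℕ => lp.single (E := fun _ : ℕ => ℂ) 1 n 1)) :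
        Set (lp (fun _ : ℕ => ℂ) 1)) :=
    ((countable_range _).isSeparable.span (R := ℂ)).closure
  rw [← TopologicalSpace.isSeparable_univ_iff]
  refine h.mono fun a _ => ?_
  refine mem_closure_of_tendsto (lp.hasSum_single ENNReal.one_ne_top a)
    (Eventually.of_forall fun s => Submodule.sum_mem _ fun n _ => ?_)
  have : lp.single 1 n (a n) = a n • lp.single (E := fun _ : ℕ => ℂ) 1 n 1 := by
    rw [← lp.single_smul, smul_eq_mul, mul_one]
  rw [this]
  exact Submodule.smul_mem _ _ (Submodule.subset_span ⟨n, rfl⟩)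

/-- A compact contraction factors as a quotient map, onto a space in a given universe, followed by
an injective compact contraction. -/
theorem exists_quotient_injective_factorization {Z : Type} {F : Type*} [NormedAddCommGroup Z]
    [NormedSpace ℂ Z] [CompleteSpace Z] [TopologicalSpace.SeparableSpace Z]
    [NormedAddCommGroup F] [NormedSpace ℂ F] [CompleteSpace F] {S₀ : Z →L[ℂ] F}
    (hc : IsCompactOperator S₀) (h1 : ‖S₀‖ ≤ 1) :
    ∃ (G : Type w) (_ : NormedAddCommGroup G) (_ : NormedSpace ℂ G) (_ : CompleteSpace G)
      (_ : TopologicalSpace.SeparableSpace G) (J : Z →L[ℂ] G) (S : G →L[ℂ] F),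
      (∀ z, S (J z) = S₀ z) ∧ (∀ z, ‖J z‖ ≤ ‖z‖) ∧ Function.Injective S ∧
      IsCompactOperator S ∧ ‖S‖ ≤ 1 := by
  set N := S₀.ker with hN
  have : IsClosed (N : Set Z) := S₀.isClosed_ker
  -- An isometric copy of the quotient in the universe prescribed for $G$.
  let e : ULift.{w} (Z ⧸ N) ≃ₗᵢ[ℂ] Z ⧸ N := LinearIsometryEquiv.ulift ℂ (Z ⧸ N)
  let J : Z →L[ℂ] ULift.{w} (Z ⧸ N) :=
    (e.symm.toContinuousLinearEquiv : (Z ⧸ N) →L[ℂ] _).comp N.mkQL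
  let S : ULift.{w} (Z ⧸ N) →L[ℂ] F :=
    (N.liftQL S₀ le_rfl).comp (e.toContinuousLinearEquiv : _ →L[ℂ] (Z ⧸ N))
  have hSJ : ∀ z, S (J z) = S₀ z := fun z => by simp [S, J]
  have hJn : ∀ z, ‖J z‖ ≤ ‖z‖ := fun z => by
    simpa [J] using Submodule.Quotient.norm_mk_le N z
  have hlift : ∀ (x : ULift.{w} (Z ⧸ N)) (ε : ℝ), 0 < ε → ∃ z, J z = x ∧ ‖z‖ < ‖x‖ + ε := by
    intro x ε hε
    obtain ⟨z, hz, hz'⟩ := Submodule.Quotient.norm_mk_lt (e x) hε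
    refine ⟨z, ?_, by rwa [e.norm_map] at hz'⟩
    change e.symm (Submodule.Quotient.mk z) = x
    rw [hz, e.symm_apply_apply]
  refine ⟨ULift.{w} (Z ⧸ N), inferInstance, inferInstance, inferInstance, ?_, J, S, hSJ, hJn,
    ?_, ?_, ?_⟩
  · exact Function.Surjective.denseRange (fun x => (hlift x 1 one_pos).imp fun _ h => h.1)
      |>.separableSpace J.continuous
  · refine (injective_iff_map_eq_zero S).2 fun x hx => ?_
    obtain ⟨z, rfl, -⟩ := hlift x 1 one_pos
    rw [hSJ] at hx
    have : N.mkQ z = 0 := by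
      rw [Submodule.mkQ_apply, Submodule.Quotient.mk_eq_zero]
      exact hx
    change e.symm (N.mkQ z) = 0
    rw [this, map_zero]
  -- Open balls are used because quotient norms need not be attained: every point of the open unit
  -- ball lifts to the open unit ball of $Z$.
  · obtain ⟨K, hK, hKS⟩ := hc.image_ball_subset_compact 1
    refine (isCompactOperator_iff_image_ball_subset_compact (S : ULift.{w} (Z ⧸ N) →ₗ[ℂ] F) one_pos).2
      ⟨K, hK, ?_⟩
    rintro _ ⟨x, hx, rfl⟩
    rw [mem_ball_zero_iff] at hx
    obtain ⟨z, rfl, hz⟩ := hlift x (1 - ‖x‖) (by linarith)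
    exact hKS ⟨z, by rw [mem_ball_zero_iff]; linarith, (hSJ z).symm⟩
  · refine ContinuousLinearMap.opNorm_le_bound _ zero_le_one fun x => ?_
    refine le_of_forall_pos_le_add fun ε hε => ?_
    obtain ⟨z, rfl, hz⟩ := hlift x ε hε
    rw [hSJ, one_mul]
    exact (S₀.le_of_opNorm_le h1 z).trans (by rw [one_mul]; exact hz.le)

end Operators


/-! ### Images of $p$-convex hulls and bounds for $m_{\mathcal K_p}$. -/

section PConvex

variable {p : ℝ≥0∞} {F G : Type*} [NormedAddCommGroup F] [NormedSpace ℂ F]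
  [NormedAddCommGroup G] [NormedSpace ℂ G]

theorem map_mem_pConv (A : G →L[ℂ] F) {x : ℕ → G} {y : G} (hy : y ∈ pConv p x) :
    A y ∈ pConv p fun n => A (x n) := by
  obtain ⟨a, ha, hs⟩ := hy
  exact ⟨a, ha, by simpa using hs.mapL A⟩

theorem exists_lp_map (hp : 1 ≤ p) (A : G →L[ℂ] F) (x : lp (fun _ : ℕ => G) p) :
    ∃ x' : lp (fun _ : ℕ => F) p, (∀ n, x' n = A (x n)) ∧ ‖x'‖ ≤ ‖A‖ * ‖x‖ := by
  have : Fact (1 ≤ p) := ⟨hp⟩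
  set Φ := lp.mapCLM (E := fun _ : ℕ => G) (F := fun _ : ℕ => F) p (fun _ => A) (norm_nonneg A)
    (fun _ => le_rfl) with hΦ
  have hΦn : ‖Φ‖ ≤ ‖A‖ := lp.norm_mapCLM_le _ _ _ _
  exact ⟨Φ x, fun n => by rw [hΦ, lp.mapCLM_apply_coe], Φ.le_of_opNorm_le hΦn x⟩

theorem pCompactMeasure_le {K : Set F} {x : lp (fun _ : ℕ => F) p} (h : K ⊆ pConv p x) :
    pCompactMeasure p K ≤ ‖x‖ :=
  csInf_le ⟨0, by rintro _ ⟨y, -, rfl⟩; exact lp.norm_nonneg' y⟩ ⟨x, h, rfl⟩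

theorem le_pCompactMeasure {K : Set F} (hK : IsRelPCompact p K) {b : ℝ}
    (h : ∀ x : lp (fun _ : ℕ => F) p, K ⊆ pConv p x → b ≤ ‖x‖) : b ≤ pCompactMeasure p K := by
  obtain ⟨x, hx⟩ := hK
  exact le_csInf ⟨_, x, hx, rfl⟩ (by rintro _ ⟨y, hy, rfl⟩; exact h y hy)

theorem pCompactMeasure_nonneg (K : Set F) : 0 ≤ pCompactMeasure p K :=
  Real.sInf_nonneg (by rintro _ ⟨y, -, rfl⟩; exact lp.norm_nonneg' y)

end PConvex

/-! ### From factorizations to $p$-compactness and back. -/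

section Factorization

theorem norm_weight_smul {E : Type*} [NormedAddCommGroup E] {U : Set E} {v : E → ℝ}
    (hv : IsWeight U v) {X : Type*} [SeminormedAddCommGroup X]
    [NormedSpace ℂ X] (g : E → X) {x : E} (hx : x ∈ U) :
    ‖(v x : ℂ) • g x‖ = v x * ‖g x‖ := by
  rw [norm_smul, Complex.norm_real, Real.norm_of_nonneg (hv.2 x hx).le]

theorem vNorm_nonneg {E : Type*} [NormedAddCommGroup E] {U : Set E} {v : E → ℝ}
    (hv : IsWeight U v) {X : Type*} [SeminormedAddCommGroup X]
    [NormedSpace ℂ X] (g : E → X) : 0 ≤ vNorm U v g :=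
  Real.sSup_nonneg (by
    rintro _ ⟨x, hx, rfl⟩
    exact mul_nonneg (hv.2 x hx).le (norm_nonneg _))

variable {E F : Type*} [NormedAddCommGroup E] [NormedSpace ℂ E] [NormedAddCommGroup F]
  [NormedSpace ℂ F] {p : ℝ≥0∞} {U : Set E} {v : E → ℝ} {f : E → F}

/-- Relative compactness provides the boundedness without which the real `sSup` would be a default
value. -/
theorem MemHvK.norm_weight_smul_le {X : Type*} [SeminormedAddCommGroup X] [NormedSpace ℂ X]
    {g : E → X} (hv : IsWeight U v) (hg : MemHvK U v g) {x : E} (hx : x ∈ U) :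
    ‖(v x : ℂ) • g x‖ ≤ vNorm U v g := by
  rw [norm_weight_smul hv g hx]
  refine le_csSup ?_ ⟨x, hx, rfl⟩
  obtain ⟨C, hC⟩ := (hg.2.isBounded.subset subset_closure).exists_norm_le
  refine ⟨C, ?_⟩
  rintro _ ⟨y, hy, rfl⟩
  refine (norm_weight_smul hv g hy).symm.trans_le (hC _ ⟨y, hy, rfl⟩)

variable {G : Type*} [NormedAddCommGroup G] [NormedSpace ℂ G] {M : Submodule ℂ (DualSeq p)}
  {T : (DualSeq p ⧸ M) →L[ℂ] G} {g : E → DualSeq p ⧸ M} {S : G →L[ℂ] F}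

/-- Pushing a `p`-convex hull forward along a factorization. -/
theorem IsFactorization.exists_vRange_subset_pConv (hp : 1 ≤ p) (hv : IsWeight U v)
    (h : IsFactorization p U v f M T g S) {x : lp (fun _ : ℕ => G) p}
    (hx : T '' closedBall 0 1 ⊆ pConv p x) :
    ∃ x' : lp (fun _ : ℕ => F) p, vRange U v f ⊆ pConv p x' ∧
      ‖x'‖ ≤ ‖S‖ * ‖x‖ * vNorm U v g := by
  obtain ⟨-, -, hg, -, hfac⟩ := h
  set C := vNorm U v g
  have hC : 0 ≤ C := vNorm_nonneg hv g
  obtain ⟨x', hx', hx'n⟩ := exists_lp_map hp ((C : ℂ) • S) x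
  refine ⟨x', ?_, hx'n.trans_eq ?_⟩
  · have key : ∀ z : DualSeq p ⧸ M, ‖z‖ ≤ C →
        ∃ z' : DualSeq p ⧸ M, ‖z'‖ ≤ 1 ∧ T z = (C : ℂ) • T z' := by
      intro z hz
      rcases hC.eq_or_lt' with h0 | h0
      -- The quotient carries only a seminorm here, so $\|z\|=0$ need not give $z=0$; boundedness of
      -- $T$ still gives $Tz=0$.
      · refine ⟨0, by simp, ?_⟩
        rw [map_zero, smul_zero, ← norm_le_zero_iff]
        refine (T.le_opNorm z).trans ?_
        rw [h0] at hz
        rw [le_antisymm hz (norm_nonneg z), mul_zero]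
      · have hC0 : (C : ℂ) ≠ 0 := by exact_mod_cast h0.ne'
        refine ⟨(C : ℂ)⁻¹ • z, ?_, by rw [map_smul, smul_inv_smul₀ hC0]⟩
        rw [norm_smul, norm_inv, Complex.norm_real, Real.norm_of_nonneg hC,
          inv_mul_le_iff₀ h0, mul_one]
        exact hz
    rintro _ ⟨e, he, rfl⟩
    obtain ⟨z', hz', hTz⟩ := key _ (hg.norm_weight_smul_le hv he)
    have h1 : (v e : ℂ) • f e = ((C : ℂ) • S) (T z') := by
      rw [hfac e he, ← map_smul, ← map_smul, hTz, map_smul]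
      rfl
    have h2 := map_mem_pConv ((C : ℂ) • S) (hx ⟨z', by simpa using hz', rfl⟩)
    simp only [← hx'] at h2
    change (v e : ℂ) • f e ∈ _
    rwa [h1]
  · rw [norm_smul, Complex.norm_real, Real.norm_of_nonneg hC]
    ring

theorem IsFactorization.isRelPCompact (hp : 1 ≤ p) (hv : IsWeight U v)
    (h : IsFactorization p U v f M T g S) : IsRelPCompact p (vRange U v f) := by
  obtain ⟨x, hx⟩ := h.2.1
  obtain ⟨x', hx', -⟩ := h.exists_vRange_subset_pConv hp hv hx
  exact ⟨x', hx'⟩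

theorem IsFactorization.vKpNorm_le (hp : 1 ≤ p) (hv : IsWeight U v)
    (h : IsFactorization p U v f M T g S) :
    vKpNorm p U v f ≤ ‖S‖ * pCompactOpNorm p T * vNorm U v g := by
  have key : ∀ x : lp (fun _ : ℕ => G) p, T '' closedBall 0 1 ⊆ pConv p x →
      vKpNorm p U v f ≤ ‖S‖ * vNorm U v g * ‖x‖ := by
    intro x hx
    obtain ⟨x', hx', hn⟩ := h.exists_vRange_subset_pConv hp hv hx
    calc vKpNorm p U v f ≤ ‖x'‖ := pCompactMeasure_le hx'
      _ ≤ _ := hn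
      _ = _ := by ring
  have hC : 0 ≤ ‖S‖ * vNorm U v g := mul_nonneg (norm_nonneg S) (vNorm_nonneg hv g)
  rw [mul_right_comm]
  -- The infimum over $x$ is reached by dividing by the constant; when it is $0$, a single
  -- admissible $x$ suffices.
  rcases hC.eq_or_lt' with h0 | h0
  · obtain ⟨x, hx⟩ := h.2.1
    simpa [h0] using key x hx
  · rw [← div_le_iff₀' h0]
    refine le_pCompactMeasure h.2.1 fun x hx => ?_
    rw [div_le_iff₀' h0]
    exact key x hx

/-- A map whose weighted range lies in the `p`-convex hull of `y` factors with constants arbitrarily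
close to the norm of `y`. -/
theorem exists_isFactorization [CompleteSpace F] (hU : IsOpen U) (hv : IsWeight U v)
    (hp : 1 ≤ p) (hp' : p ≠ ∞) (hf : DifferentiableOn ℂ f U) {y : lp (fun _ : ℕ => F) p}
    (hy : vRange U v f ⊆ pConv p y) {η : ℝ} (hη : ‖y‖ < η) :
    ∃ (M : Submodule ℂ (DualSeq p)) (G : Type w) (_ : NormedAddCommGroup G)
      (_ : NormedSpace ℂ G) (_ : CompleteSpace G) (_ : TopologicalSpace.SeparableSpace G)
      (T : (DualSeq p ⧸ M) →L[ℂ] G) (g : E → DualSeq p ⧸ M) (S : G →L[ℂ] F),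
      IsFactorization p U v f M T g S ∧ ‖S‖ ≤ 1 ∧ pCompactOpNorm p T ≤ η ∧ vNorm U v g ≤ 1 := by
  classical
  have : Fact (1 ≤ p) := ⟨hp⟩
  -- The slack is spent twice: $\eta'$ bounds $\|\beta\|$, and $c=\eta/\eta'>1$ bounds
  -- representatives of the quotient's closed unit ball.
  obtain ⟨η', hη1, hη2⟩ := exists_between hη
  have hη' : 0 < η' := (lp.norm_nonneg' y).trans_lt hη1
  set c : ℝ := η / η' with hc
  have hc1 : 1 < c := (one_lt_div hη').2 hη2
  have hc0 : 0 < c := one_pos.trans hc1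
  obtain ⟨t, β, ht0, ht1, htt, hβn, hβ⟩ := exists_null_seq_lp_div_sq hp hp' y hη1
  -- the two diagonal operators and the operator on `ℓ_1`
  have htC : Tendsto (fun n => (t n : ℂ)) atTop (𝓝 0) := by
    exact_mod_cast (Complex.continuous_ofReal.tendsto 0).comp htt
  have htC1 : ∀ n, ‖(t n : ℂ)‖ ≤ 1 := fun n => by
    rw [Complex.norm_real, Real.norm_of_nonneg (ht0 n).le]
    exact ht1 n
  obtain ⟨D, hDc, hDn, hD⟩ := exists_isCompactOperator_diagonal p htC htC1
  obtain ⟨B, hB⟩ := exists_mul_toLp_one hp β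
  set u : ℕ → F := fun n => (‖y n‖ : ℂ)⁻¹ • y n with hu
  have hu1 : ∀ n, ‖u n‖ ≤ 1 := fun n => by
    rw [hu, norm_smul, norm_inv, Complex.norm_real, norm_norm]
    exact inv_mul_le_one
  have hsn : ∀ n, ‖(t n : ℂ) • u n‖ ≤ ‖(t n : ℂ)‖ := fun n => by
    rw [norm_smul]
    exact mul_le_of_le_one_right (norm_nonneg _) (hu1 n)
  obtain ⟨S₀, hS₀c, hS₀n, hS₀⟩ := exists_isCompactOperator_of_tendsto_zero
    (s := fun n => (t n : ℂ) • u n)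
    (squeeze_zero_norm hsn (by simpa using htC.norm)) fun n => (hsn n).trans (htC1 n)
  obtain ⟨G, _, _, _, _, J, S, hSJ, hJn, hSi, hSc, hSn⟩ :=
    exists_quotient_injective_factorization.{w} hS₀c hS₀n
  have hcoef : ∀ n, ((t n : ℂ) * β n * t n * (‖y n‖ : ℂ)⁻¹) • y n = y n := by
    intro n
    rcases eq_or_ne (y n) 0 with h0 | h0
    · rw [h0, smul_zero]
    · have h1 : (‖y n‖ : ℂ) ≠ 0 := by exact_mod_cast norm_ne_zero_iff.2 h0
      have h2 : (t n : ℂ) ≠ 0 := by exact_mod_cast (ht0 n).ne'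
      convert one_smul ℂ (y n) using 2
      rw [hβ]
      push_cast
      field_simp
  -- the quotient of `DualSeq p`
  set Q : DualSeq p →L[ℂ] G := J.comp B with hQ
  set M : Submodule ℂ (DualSeq p) := Q.ker with hM
  have hMc : IsClosed (M : Set (DualSeq p)) := Q.isClosed_ker
  set T : (DualSeq p ⧸ M) →L[ℂ] G := M.liftQL Q le_rfl with hT
  have hTm : ∀ a, T (M.mkQL a) = Q a := fun a => by simp [hT]
  have hTi : Function.Injective T := by
    refine (injective_iff_map_eq_zero T).2 fun z hz => ?_
    obtain ⟨a, rfl⟩ := M.mkQ_surjective z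
    rw [Submodule.mkQ_apply, Submodule.Quotient.mk_eq_zero]
    exact hz
  have hSTi : Function.Injective (S.comp T) := hSi.comp hTi
  -- `T` is `p`-compact
  obtain ⟨x, hx, hxn⟩ : ∃ x : lp (fun _ : ℕ => G) p,
      T '' closedBall 0 1 ⊆ pConv p x ∧ ‖x‖ ≤ η := by
    have hJe : ∀ n, ‖ContinuousLinearMap.toSpanSingleton ℂ
        (J (lp.single (E := fun _ : ℕ => ℂ) 1 n 1))‖ ≤ 1 := fun n => by
      rw [ContinuousLinearMap.norm_toSpanSingleton]
      refine (hJn _).trans ?_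
      rw [lp.norm_single one_pos, norm_one]
    -- Here $x_{0,n}=\beta_nJe_n$, so $T[a]=J(Ba)=\sum a_nx_{0,n}$; the factor $c$ below compensates
    -- for $\|a\|<c$.
    set x₀ := lp.mapCLM (E := fun _ : ℕ => ℂ) (F := fun _ : ℕ => G) p _ zero_le_one hJe β with hx₀
    have hx₀n : ‖x₀‖ ≤ ‖β‖ := by
      simpa using (lp.mapCLM (E := fun _ : ℕ => ℂ) (F := fun _ : ℕ => G) p _ zero_le_one
        hJe).le_of_opNorm_le (lp.norm_mapCLM_le _ _ zero_le_one hJe) β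
    refine ⟨(c : ℂ) • x₀, ?_, ?_⟩
    · rintro _ ⟨z, hz, rfl⟩
      rw [mem_closedBall_zero_iff] at hz
      obtain ⟨a, rfl, ha⟩ := Submodule.Quotient.norm_mk_lt z (sub_pos.2 hc1)
      refine ⟨(c : ℂ)⁻¹ • a, ?_, ?_⟩
      · rw [norm_smul, norm_inv, Complex.norm_real, Real.norm_of_nonneg hc0.le,
          inv_mul_le_iff₀ hc0]
        linarith
      · have hs := (lp.hasSum_single ENNReal.one_ne_top (B a)).mapL J
        have hTa : T (Submodule.Quotient.mk a) = J (B a) := hTm a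
        rw [hTa]
        convert hs using 2 with n
        have hcoord : ((c : ℂ)⁻¹ • a).coord n = (c : ℂ)⁻¹ * a.coord n := rfl
        have hxn : ((c : ℂ) • x₀ : lp (fun _ : ℕ => G) p) n =
          (c : ℂ) • β n • J (lp.single (E := fun _ : ℕ => ℂ) 1 n 1) := rfl
        have hsing : lp.single 1 n (B a n) =
            (a.coord n * β n) • lp.single (E := fun _ : ℕ => ℂ) 1 n 1 := by
          rw [← lp.single_smul, smul_eq_mul, mul_one, hB]
        have hcc : (c : ℂ) ≠ 0 := by exact_mod_cast hc0.ne'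
        rw [hcoord, hxn, hsing, map_smul, smul_smul, smul_smul]
        congr 1
        field_simp
    · calc ‖(c : ℂ) • x₀‖ = c * ‖x₀‖ := by
            rw [norm_smul, Complex.norm_real, Real.norm_of_nonneg hc0.le]
        _ ≤ c * η' := mul_le_mul_of_nonneg_left (hx₀n.trans hβn) hc0.le
        _ = η := by rw [hc, div_mul_cancel₀ _ hη'.ne']
  -- the holomorphic map `g`
  have hch : ∀ e : E, ∃ a : DualSeq p, ‖a‖ ≤ 1 ∧
      (e ∈ U → HasSum (fun n => a.coord n • y n) ((v e : ℂ) • f e)) := by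
    intro e
    by_cases he : e ∈ U
    · obtain ⟨a, ha, hs⟩ := hy ⟨e, he, rfl⟩
      exact ⟨a, ha, fun _ => hs⟩
    · exact ⟨0, by simp, fun h => absurd h he⟩
  choose a ha1 has using hch
  set k : E → DualSeq p ⧸ M := fun e => M.mkQL (D (a e)) with hk
  set g : E → DualSeq p ⧸ M := fun e => (v e : ℂ)⁻¹ • k e with hg
  have hv0 : ∀ e ∈ U, (v e : ℂ) ≠ 0 := fun e he => by exact_mod_cast (hv.2 e he).ne'
  have hvg : ∀ e ∈ U, (v e : ℂ) • g e = k e := fun e he => smul_inv_smul₀ (hv0 e he) _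
  have hSTk : ∀ e ∈ U, S.comp T (k e) = (v e : ℂ) • f e := by
    intro e he
    have h1 : S.comp T (k e) = S₀ (B (D (a e))) := by
      change S (T (M.mkQL (D (a e)))) = _
      rw [hTm, ← hSJ]
      rfl
    rw [h1]
    refine (hS₀ _).unique ?_
    convert has e he using 2 with n
    conv_rhs => rw [← hcoef n]
    rw [hB, hD, hu, smul_smul, smul_smul, smul_smul]
    congr 1
    ring
  have hSTg : ∀ e ∈ U, S.comp T (g e) = f e := fun e he => by
    rw [hg, map_smul, hSTk e he, inv_smul_smul₀ (hv0 e he)]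
  obtain ⟨K, hK, hKk⟩ : ∃ K : Set (DualSeq p ⧸ M), IsCompact K ∧ ∀ e, k e ∈ K := by
    obtain ⟨K, hK, hDK⟩ := IsCompactOperator.image_closedBall_subset_compact
      (f := (D : DualSeq p →ₗ[ℂ] DualSeq p)) hDc 1
    exact ⟨M.mkQL '' K, hK.image M.mkQL.continuous, fun e =>
      ⟨_, hDK ⟨a e, by simpa using ha1 e, rfl⟩, rfl⟩⟩
  have hvc : ContinuousOn (fun e => (v e : ℂ)) U :=
    Complex.continuous_ofReal.comp_continuousOn hv.1
  -- Although $a$ is chosen arbitrarily, injectivity of $ST$ makes $k$ on $U$ independent of the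
  -- choice; compactness of $K$ gives continuity.
  have hkc : ContinuousOn k U :=
    continuousOn_of_injective_comp (S.comp T).continuous hSTi hK (fun e _ => hKk e)
      ((hvc.smul hf.continuousOn).congr hSTk)
  have hgd : DifferentiableOn ℂ g U :=
    differentiableOn_of_injective_comp hSTi hU ((hvc.inv₀ hv0).smul hkc) (hf.congr hSTg)
  refine ⟨M, G, inferInstance, inferInstance, inferInstance, inferInstance, T, g, S,
    ⟨hMc, ⟨x, hx⟩, ⟨hgd, ?_⟩, hSc, fun e he => (hSTg e he).symm⟩, hSn,
    (pCompactMeasure_le hx).trans hxn, ?_⟩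
  · refine hK.closure_of_subset ?_
    rintro _ ⟨e, he, rfl⟩
    change (v e : ℂ) • g e ∈ K
    rw [hvg e he]
    exact hKk e
  · refine Real.sSup_le ?_ zero_le_one
    rintro _ ⟨e, he, rfl⟩
    change v e * ‖g e‖ ≤ 1
    rw [← norm_weight_smul hv g he, hvg e he]
    refine (Submodule.Quotient.norm_mk_le M (D (a e))).trans ?_
    refine (D.le_of_opNorm_le hDn _).trans ?_
    rw [one_mul]
    exact ha1 e

end Factorization

end WeightedHol

theorem mainTheorem12 {E : Type*} [NormedAddCommGroup E] [NormedSpace ℂ E]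
    [CompleteSpace E] {F : Type*} [NormedAddCommGroup F] [NormedSpace ℂ F] [CompleteSpace F]
    (U : Set E) (hU : IsOpen U) (v : E → ℝ) (hv : WeightedHol.IsWeight U v)
    (p : ℝ≥0∞) (hp : 1 ≤ p) (hp' : p ≠ ∞) (f : E → F) (hf : WeightedHol.MemHv U v f) :
    (WeightedHol.MemHvKp p U v f ↔
      ∃ (M : Submodule ℂ (WeightedHol.DualSeq p))
        (G : Type w) (_ : NormedAddCommGroup G) (_ : NormedSpace ℂ G)
        (_ : CompleteSpace G) (_ : TopologicalSpace.SeparableSpace G)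
        (T : (WeightedHol.DualSeq p ⧸ M) →L[ℂ] G) (g : E → WeightedHol.DualSeq p ⧸ M)
        (S : G →L[ℂ] F), WeightedHol.IsFactorization p U v f M T g S) ∧
    (WeightedHol.MemHvKp p U v f →
      IsGLB {r : ℝ | ∃ (M : Submodule ℂ (WeightedHol.DualSeq p))
        (G : Type w) (_ : NormedAddCommGroup G) (_ : NormedSpace ℂ G)
        (_ : CompleteSpace G) (_ : TopologicalSpace.SeparableSpace G)
        (T : (WeightedHol.DualSeq p ⧸ M) →L[ℂ] G) (g : E → WeightedHol.DualSeq p ⧸ M)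
        (S : G →L[ℂ] F), WeightedHol.IsFactorization p U v f M T g S ∧
          r = ‖S‖ * WeightedHol.pCompactOpNorm p T * WeightedHol.vNorm U v g}
        (WeightedHol.vKpNorm p U v f)) := by
  refine ⟨⟨fun h => ?_, ?_⟩, fun h => ⟨?_, fun b hb => ?_⟩⟩
  · obtain ⟨y, hy⟩ := h.2
    obtain ⟨M, G, i₁, i₂, i₃, i₄, T, g, S, hfac, -⟩ :=
      WeightedHol.exists_isFactorization.{w} hU hv hp hp' hf.1 hy (lt_add_one ‖y‖)
    exact ⟨M, G, i₁, i₂, i₃, i₄, T, g, S, hfac⟩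
  · rintro ⟨M, G, i₁, i₂, i₃, i₄, T, g, S, hfac⟩
    exact ⟨hf, hfac.isRelPCompact hp hv⟩
  · rintro _ ⟨M, G, i₁, i₂, i₃, i₄, T, g, S, hfac, rfl⟩
    exact hfac.vKpNorm_le hp hv
  · refine WeightedHol.le_pCompactMeasure h.2 fun y hy => ?_
    -- The infimum need not be attained, so the lower bound $b$ is compared with every $\eta>\|y\|$.
    refine le_of_forall_gt_imp_ge_of_dense fun η hη => ?_
    obtain ⟨M, G, i₁, i₂, i₃, i₄, T, g, S, hfac, hS, hT, hg⟩ :=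
      WeightedHol.exists_isFactorization.{w} hU hv hp hp' hf.1 hy hη
    have h0 : 0 ≤ WeightedHol.pCompactOpNorm p T := WeightedHol.pCompactMeasure_nonneg _
    calc b ≤ ‖S‖ * WeightedHol.pCompactOpNorm p T * WeightedHol.vNorm U v g :=
          hb ⟨M, G, i₁, i₂, i₃, i₄, T, g, S, hfac, rfl⟩
      _ ≤ 1 * η * 1 := by
          have h1 := WeightedHol.vNorm_nonneg hv g
          have h2 : 0 ≤ η := h0.trans hT
          gcongr
      _ = η := by ring
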